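/- Let $\Bbbk$ be an algebraically closed field and let $A$ be a finite dimensional unital $\Bbbk$-algebra that is basic (all simple $A$-modules are one-dimensional). Let $A\text{-}\mathrm{mod}$ be the category of finite dimensional left $A$-modules, let $L_1,\dots,L_n$ be a complete list of pairwise nonisomorphic simple $A$-modules, and let $P_i\twoheadrightarrow L_i$ be projective covers. All functors are additive and $\Bbbk$-linear; an endofunctor is selfadjoint if it is adjoint to itself. For a polynomial $g(x)=\sum_m g_m x^m$ with nonnegative integer coefficients and an endofunctor $\mathrm{G}$, put $g(\mathrm{G})=\bigoplus_m (\mathrm{G}^m)^{\oplus g_m}$, where $\mathrm{G}^0$ is the identity functor. Let $S\subsetneq\{1,\dots,n\}$ and $S'=\{1,\dots,n\}\setminus S$. Let $\mathcal{N}_S$ be the full subcategory of all $N\in A\text{-}\mathrm{mod}$ such that $[N:L_i]\neq 0$ implies $i\in S$. Put $P_{S'}=\bigoplus_{i\in S'}P_i$, let $B_{S'}=\mathrm{End}_A(P_{S'})^{\mathrm{op}}$, let $I_S\subseteq A$ be the trace of $P_{S'}$ in ${}_AA$ (the sum of the images of all homomorphisms $P_{S'}\to A$; it is a two-sided ideal),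 and let $D_S=A/I_S$. Let $\mathrm{add}(P_{S'})$ be the class of all modules isomorphic to finite direct sums of direct summands of $P_{S'}$, and let $\mathcal{X}_{P_{S'}}$ be the full subcategory of all modules $Y$ admitting an exact sequence $X_1\to X_0\to Y\to 0$ with $X_0,X_1\in\mathrm{add}(P_{S'})$. Let $\mathrm{F}$ be a selfadjoint endofunctor of $A\text{-}\mathrm{mod}$ (so that $\mathrm{F}$ is exact and induces an endomorphism $[\mathrm{F}]$ of the Grothendieck group $[A]$ of $A\text{-}\mathrm{mod}$), and assume that the linear span of the classes $[L_i]$, $i\in S$, in $[A]$ is invariant under $[\mathrm{F}]$. Then: (i) $\mathrm{F}$ preserves $\mathcal{N}_S$. Restriction of scalars along $A\to D_S$ is an equivalence $\Psi\colon D_S\text{-}\mathrm{mod}\to\mathcal{N}_S$, and $\hat{\mathrm{F}}:=\Psi^{-1}\circ\mathrm{F}|_{\mathcal{N}_S}\circ\Psi$ is a selfadjoint (additive, $\Bbbk$-linear) endofunctor of $D_S\text{-}\mathrm{mod}$. (ii) $\mathrm{F}$ preserves $\mathcal{X}_{P_{S'}}$. The functor $\Phi=\mathrm{Hom}_A(P_{S'},-)\colon\mathcal{X}_{P_{S'}}\to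 B_{S'}\text{-}\mathrm{mod}$ is an equivalence, and $\overline{\mathrm{F}}:=\Phi\circ\mathrm{F}|_{\mathcal{X}_{P_{S'}}}\circ\Phi^{-1}$ is a selfadjoint (additive, $\Bbbk$-linear) endofunctor of $B_{S'}\text{-}\mathrm{mod}$. (iii) If $g(x),h(x)$ are polynomials with nonnegative integer coefficients and $g(\mathrm{F})\cong h(\mathrm{F})$, then $g(\hat{\mathrm{F}})\cong h(\hat{\mathrm{F}})$ and $g(\overline{\mathrm{F}})\cong h(\overline{\mathrm{F}})$. -/

import Mathlib

open CategoryTheory CategoryTheory.Limits Polynomial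

universe w u v v₁ v₂ u₁ u₂

namespace SelfadjointFunctors

noncomputable section

/-! ### Finite direct sums of finitely generated modules -/

theorem isClosedUnderFiniteProducts_isFG (R : Type u) [Ring R] :
    (ModuleCat.isFG.{u} R).IsClosedUnderFiniteProducts where
  isClosedUnderLimitsOfShape J _ := by
    have : (ModuleCat.isFG.{u} R).IsClosedUnderIsomorphisms :=
      ⟨fun {M N} e (_ : Module.Finite R M) => Module.Finite.equiv e.toLinearEquiv⟩
    refine ObjectProperty.IsClosedUnderLimitsOfShape.mk' ?_
    rintro _ ⟨G, hG⟩
    have : ∀ j : J, Module.Finite R (G.obj ⟨j⟩) := fun j => hG ⟨j⟩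
    have h : ModuleCat.isFG R (∏ᶜ fun j : J => G.obj ⟨j⟩) :=
      (inferInstance : Module.Finite R (∏ᶜ fun j : J => G.obj ⟨j⟩ : ModuleCat.{u} R))
    exact (ModuleCat.isFG R).prop_of_iso (HasLimit.isoOfNatIso
      (Discrete.natIso fun j => Iso.refl _ : Discrete.functor (fun j : J => G.obj ⟨j⟩) ≅ G)) h

instance hasFiniteBiproducts_fgModuleCat (R : Type u) [Ring R] :
    HasFiniteBiproducts (FGModuleCat.{u} R) := by
  have := isClosedUnderFiniteProducts_isFG R
  have h : HasFiniteProducts (FGModuleCat.{u} R) := ⟨fun n => inferInstance⟩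
  exact HasFiniteBiproducts.of_hasFiniteProducts

/-! ### Basic algebras, simple modules, projective covers, multiplicities -/

/-- `A` is basic over `k`: every simple `A`-module is one-dimensional over `k`. -/
def IsBasicAlgebra (k : Type w) (A : Type u) [Field k] [Ring A] [Algebra k A] : Prop :=
  ∀ (M : Type u) [AddCommGroup M] [Module k M] [Module A M] [IsScalarTower k A M]
    [IsSimpleModule A M], Module.finrank k M = 1

section Modules

variable {A : Type u} [Ring A]

/-- `L` is a complete list of pairwise nonisomorphic simple modules. -/
structure IsCompleteSimpleList {n : ℕ} (L : Fin n → FGModuleCat.{u} A) : Prop where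
  simple : ∀ i, IsSimpleModule A (L i)
  pairwise : ∀ i j, Nonempty (L i ≅ L j) → i = j
  complete : ∀ M : FGModuleCat.{u} A, IsSimpleModule A M → ∃ i, Nonempty (M ≅ L i)

/-- `π : P ⟶ L` is a projective cover: `P` is projective and `π` is a surjection with
superfluous kernel. -/
structure IsProjectiveCover {P L : FGModuleCat.{u} A} (π : P ⟶ L) : Prop where
  projective : Module.Projective A P
  surjective : Function.Surjective π.hom.hom
  superfluous : ∀ N : Submodule A P, N ⊔ LinearMap.ker π.hom.hom = ⊤ → N = ⊤

/-- The subquotient `s (j + 1) / s j` of a chain of submodules. -/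
abbrev Subfactor {M : Type u} [AddCommGroup M] [Module A M]
    (s : CompositionSeries (Submodule A M)) (j : Fin s.length) : Type u :=
  ↥(s j.succ) ⧸ (s j.castSucc).submoduleOf (s j.succ)

/-- The composition multiplicity `[M : L]`, i.e. the number of subquotients isomorphic to `L`
in a composition series of `M` (all composition series give the same number). -/
def compositionMultiplicity (M L : FGModuleCat.{u} A) : ℕ :=
  sInf {m | ∃ s : CompositionSeries (Submodule A M), s.head = ⊥ ∧ s.last = ⊤ ∧
    m = Nat.card {j : Fin s.length // Nonempty (Subfactor s j ≃ₗ[A] L)}}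

/-- The subcategory `𝒩_S`: all `M` such that `[M : L i] ≠ 0` implies `i ∈ S`. -/
def serre {n : ℕ} (L : Fin n → FGModuleCat.{u} A) (S : Set (Fin n)) :
    ObjectProperty (FGModuleCat.{u} A) :=
  fun M => ∀ i, compositionMultiplicity M (L i) ≠ 0 → i ∈ S

/-- `P_T`, the direct sum of the `P i` with `i ∈ T`. -/
def coverSum {n : ℕ} (P : Fin n → FGModuleCat.{u} A) (T : Set (Fin n)) : FGModuleCat.{u} A :=
  ⨁ fun i : T => P i

/-- The trace of a module `X` in the regular module: the sum of the images of all
homomorphisms `X → A`. -/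
def traceIdeal (X : FGModuleCat.{u} A) : Ideal A :=
  ⨆ f : X →ₗ[A] A, LinearMap.range f

instance isTwoSided_traceIdeal (X : FGModuleCat.{u} A) : (traceIdeal X).IsTwoSided where
  mul_mem_of_left {a} b ha := by
    have h : traceIdeal X ≤ Submodule.comap (LinearMap.toSpanSingleton A A b) (traceIdeal X) := by
      refine iSup_le fun f => ?_
      rintro _ ⟨x, rfl⟩
      exact Submodule.mem_iSup_of_mem ((LinearMap.toSpanSingleton A A b).comp f) ⟨x, rfl⟩
    exact h ha

/-- The quotient `D_S` of `A` by the trace `I_S` of `P_{S'}`, where `S'` is the complement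
of `S`. -/
abbrev quotientAlgebra {n : ℕ} (P : Fin n → FGModuleCat.{u} A) (S : Set (Fin n)) : Type u :=
  A ⧸ traceIdeal (coverSum P Sᶜ)

/-- The algebra `B_T = End_A(P_T)ᵒᵖ`. -/
abbrev centralizerAlgebra {n : ℕ} (P : Fin n → FGModuleCat.{u} A) (T : Set (Fin n)) : Type u :=
  (End (coverSum P T))ᵐᵒᵖ

/-- Restriction of scalars along `A → A / I` for finitely generated modules. -/
def quotientRestrict (I : Ideal A) [I.IsTwoSided] :
    FGModuleCat.{u} (A ⧸ I) ⥤ FGModuleCat.{u} A :=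
  (ModuleCat.isFG A).lift
    ((ModuleCat.isFG (A ⧸ I)).ι ⋙ ModuleCat.restrictScalars (Ideal.Quotient.mk I))
    (fun M => by
      let r : Module A M := Module.compHom M (Ideal.Quotient.mk I)
      obtain ⟨t, ht⟩ := (inferInstance : Module.Finite (A ⧸ I) M).fg_top
      refine (⟨⟨t, ?_⟩⟩ : @Module.Finite A M _ _ r)
      refine (Submodule.eq_top_iff' (R := A) (M := M)).2 fun x => ?_
      have hx : x ∈ Submodule.span (A ⧸ I) (t : Set M) := ht ▸ Submodule.mem_top
      induction hx using Submodule.span_induction with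
      | mem x hx => exact Submodule.subset_span hx
      | zero => exact Submodule.zero_mem _
      | add x y _ _ hx hy => exact Submodule.add_mem _ hx hy
      | smul a x _ hx =>
        obtain ⟨a, rfl⟩ := Ideal.Quotient.mk_surjective a
        exact Submodule.smul_mem _ a hx)

end Modules

/-! ### Additive closure and presentable objects -/

section Categories

variable {C : Type u₁} [Category.{v₁} C]

/-- `add X`: the objects isomorphic to finite direct sums of direct summands of `X`. -/
def addClosure [Preadditive C] [HasFiniteBiproducts C] (X : C) : ObjectProperty C :=
  fun Y => ∃ (m : ℕ) (Z : Fin m → C), (∀ j, Nonempty (Retract (Z j) X)) ∧ Nonempty (Y ≅ ⨁ Z)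

/-- The objects `Y` with an exact sequence `X₁ ⟶ X₀ ⟶ Y ⟶ 0`, where `X₀`, `X₁` are in `add X`. -/
def presentable [Preadditive C] [HasFiniteBiproducts C] (X : C) : ObjectProperty C :=
  fun Y => ∃ (X₁ X₀ : C) (f : X₁ ⟶ X₀) (g : X₀ ⟶ Y) (hfg : f ≫ g = 0),
    addClosure X X₁ ∧ addClosure X X₀ ∧ (ShortComplex.mk f g hfg).Exact ∧ Epi g

/-- The restriction of an endofunctor to a full subcategory that it preserves. -/
def restrict (Q : ObjectProperty C) (F : C ⥤ C) (hF : ∀ X, Q X → Q (F.obj X)) :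
    Q.FullSubcategory ⥤ Q.FullSubcategory :=
  Q.lift (Q.ι ⋙ F) fun X => hF X.obj X.property

/-! ### Selfadjoint functors and polynomials in an endofunctor -/

/-- `F` is selfadjoint: it is (left, equivalently right) adjoint to itself. -/
def IsSelfadjointFunctor (F : C ⥤ C) : Prop := Nonempty (F ⊣ F)

/-- The direct sum of a finite family of endofunctors. -/
@[simps]
def directSum [Preadditive C] [HasFiniteBiproducts C] {J : Type} [Finite J] (G : J → C ⥤ C) :
    C ⥤ C where
  obj M := ⨁ fun j => (G j).obj M
  map f := biproduct.map fun j => (G j).map f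

/-- The `m`-fold composition `F ∘ ⋯ ∘ F`, which is the identity functor for `m = 0`. -/
def iterate (F : C ⥤ C) : ℕ → (C ⥤ C)
  | 0 => 𝟭 C
  | m + 1 => iterate F m ⋙ F

/-- `g(F)` for a polynomial `g` with nonnegative integral coefficients: the direct sum, over all
exponents `m`, of `g.coeff m` copies of the `m`-th power of `F`. -/
def polyFunctor [Preadditive C] [HasFiniteBiproducts C] (g : ℕ[X]) (F : C ⥤ C) : C ⥤ C :=
  directSum fun p : (Σ m : Fin (g.natDegree + 1), Fin (g.coeff m)) => iterate F p.1

/-! ### Grothendieck groups -/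

variable (C) in
/-- The subgroup generated by the `[X₂] - [X₁] - [X₃]` for the short exact sequences
`0 ⟶ X₁ ⟶ X₂ ⟶ X₃ ⟶ 0`. -/
def exactRelations [HasZeroMorphisms C] : AddSubgroup (FreeAbelianGroup C) :=
  AddSubgroup.closure {x | ∃ T : ShortComplex C, T.ShortExact ∧
    x = FreeAbelianGroup.of T.X₂ - FreeAbelianGroup.of T.X₁ - FreeAbelianGroup.of T.X₃}

variable (C) in
/-- The Grothendieck group of an abelian category. -/
abbrev GrothendieckK0 [HasZeroMorphisms C] : Type u₁ := FreeAbelianGroup C ⧸ exactRelations C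

/-- The class `[X]` of an object. -/
def K0class [HasZeroMorphisms C] (X : C) : GrothendieckK0 C :=
  QuotientAddGroup.mk (FreeAbelianGroup.of X)

theorem IsSelfadjointFunctor.map_shortExact [HasZeroMorphisms C] {F : C ⥤ C}
    [F.PreservesZeroMorphisms] (hF : IsSelfadjointFunctor F) (T : ShortComplex C)
    (hT : T.ShortExact) : (T.map F).ShortExact := by
  obtain ⟨adj⟩ := hF
  have hl := adj.rightAdjoint_preservesLimits
  have hr := adj.leftAdjoint_preservesColimits
  have : PreservesFiniteLimits F := PreservesLimits.preservesFiniteLimits F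
  have : PreservesFiniteColimits F := PreservesColimits.preservesFiniteColimits F
  exact hT.map_of_exact F

/-- The endomorphism `[F]` of the Grothendieck group, `[X] ↦ [F X]`, induced by an exact
endofunctor `F`. -/
def K0map [HasZeroMorphisms C] (F : C ⥤ C) [F.PreservesZeroMorphisms]
    (hF : ∀ T : ShortComplex C, T.ShortExact → (T.map F).ShortExact) :
    GrothendieckK0 C →+ GrothendieckK0 C :=
  QuotientAddGroup.map _ _ (FreeAbelianGroup.map F.obj) <| by
    rw [exactRelations, AddSubgroup.closure_le]
    rintro _ ⟨T, hT, rfl⟩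
    refine AddSubgroup.subset_closure ⟨T.map F, hF T hT, ?_⟩
    simp [FreeAbelianGroup.map_of_apply]

end Categories

/-- The linear span of the classes `[L i]`, `i ∈ S`, in the Grothendieck group. -/
def classSpan {A : Type u} [Ring A] {n : ℕ} (L : Fin n → FGModuleCat.{u} A) (S : Set (Fin n)) :
    Submodule ℤ (GrothendieckK0 (FGModuleCat.{u} A)) :=
  Submodule.span ℤ ((fun i => K0class (L i)) '' S)

/-! ### The centralizer algebra and its Hom functor -/

section Centralizer

open scoped ModuleCat in
theorem finite_hom (k : Type w) {A : Type u} [Field k] [Ring A] [Algebra k A]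
    [Module.Finite k A] (X Y : FGModuleCat.{u} A) : Module.Finite (End X)ᵐᵒᵖ (X ⟶ Y) := by
  have : Module.Finite k X := Module.Finite.trans A X
  have : Module.Finite k Y := Module.Finite.trans A Y
  let φ : (X ⟶ Y) →ₗ[k] (X →ₗ[k] Y) :=
    { toFun := fun f => f.hom.hom.restrictScalars k
      map_add' := fun _ _ => rfl
      map_smul' := fun _ _ => rfl }
  have hφ : Function.Injective φ := fun f g h => by
    ext x
    exact LinearMap.congr_fun h x
  have : Module.Finite k (X ⟶ Y) := Module.Finite.of_injective φ hφ
  have : IsScalarTower k (End X)ᵐᵒᵖ (X ⟶ Y) :=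
    ⟨fun c e f => Linear.smul_comp _ _ _ c e.unop f⟩
  exact Module.Finite.of_restrictScalars_finite k (End X)ᵐᵒᵖ (X ⟶ Y)

variable (k : Type w) {A : Type u} [Field k] [Ring A] [Algebra k A] [Module.Finite k A]

/-- The functor `Hom_A(X, -)` from finitely generated `A`-modules to finitely generated modules
over the centralizer algebra `End_A(X)ᵒᵖ`. -/
def homFunctor (X : FGModuleCat.{u} A) : FGModuleCat.{u} A ⥤ FGModuleCat.{u} (End X)ᵐᵒᵖ :=
  (ModuleCat.isFG (End X)ᵐᵒᵖ).lift (preadditiveCoyonedaObj X) (finite_hom k X)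

end Centralizer

end

end SelfadjointFunctors

namespace SelfadjointFunctors

noncomputable section

/-! ### Finitely generated modules over an artinian ring -/

section FGModules

variable {A : Type u} [Ring A]

/-! Everything is expressed through homs out of the projective module `P_{S'}`. A composition factor
`L i` of `M` amounts to a nonzero map `P i ⟶ M`, so `𝒩_S` consists of the `M` with `Hom(P_{S'}, M) =
0` (`serre_iff_coverFree`), which are the modules killed by the trace ideal
(`hom_eq_zero_iff_traceIdeal`); this gives `Ψ`. Since `dim Hom(P i, -)` is additive on short exact
sequences, membership in `𝒩_S` depends only on the class in the Grothendieck group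
(`coverFree_iff_mem_classSpan`), so invariance of the span forces `F` to preserve `𝒩_S`.

Adjunction moves this to the other side: for `X` in `add P_{S'}` and `i ∈ S`, `Hom(F X, L i) ≅
Hom(X, F (L i)) = 0`, and `F X` is projective. Such modules are exactly those in `add P_{S'}`
(`addClosure_coverSum_iff`); right exactness of `F` then preserves presentations. That `Φ` is an
equivalence is the usual comparison of presentations by `add X` with presentations by free
`End(X)ᵒᵖ`-modules.

Adjunctions restrict to full subcategories and transport along equivalences. For (iii), both induced
functors become `F` after a fully faithful embedding into `A`-modules, so an isomorphism of
polynomials in `F` can be pulled back and the embedding cancelled (`nonempty_polyFunctor_iso`). -/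

theorem epi_iff_surjective {X Y : FGModuleCat.{u} A} (f : X ⟶ Y) :
    Epi f ↔ Function.Surjective f.hom.hom := by
  rw [← ModuleCat.epi_iff_surjective]
  exact ⟨fun _ => inferInstanceAs (Epi ((forget₂ (FGModuleCat A) (ModuleCat A)).map f)),
    fun h => (forget₂ (FGModuleCat A) (ModuleCat A)).epi_of_epi_map h⟩

theorem mono_of_injective {X Y : FGModuleCat.{u} A} (f : X ⟶ Y)
    (hf : Function.Injective f.hom.hom) : Mono f :=
  (forget₂ (FGModuleCat A) (ModuleCat A)).mono_of_mono_map ((ModuleCat.mono_iff_injective _).2 hf)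

theorem projective_of_module_projective (X : FGModuleCat.{u} A) [Module.Projective A X] :
    Projective X where
  factors {E Y} f e he := by
    obtain ⟨h, hh⟩ := Module.projective_lifting_property e.hom.hom f.hom.hom
      ((epi_iff_surjective e).1 he)
    exact ⟨ObjectProperty.homMk (ModuleCat.ofHom h), FGModuleCat.hom_ext hh⟩

variable [IsArtinianRing A]

/-- The short exact sequence attached to a submodule of a larger submodule. -/
theorem exists_shortExact_of_le {M : FGModuleCat.{u} A} {N K : Submodule A M} (hNK : N ≤ K) :
    ∃ T : ShortComplex (FGModuleCat.{u} A), T.ShortExact ∧ T.X₁ = FGModuleCat.of A N ∧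
      T.X₂ = FGModuleCat.of A K ∧ T.X₃ = FGModuleCat.of A (K ⧸ N.submoduleOf K) := by
  let f : FGModuleCat.of A N ⟶ FGModuleCat.of A K := FGModuleCat.ofHom (Submodule.inclusion hNK)
  let g : FGModuleCat.of A K ⟶ FGModuleCat.of A (K ⧸ N.submoduleOf K) :=
    FGModuleCat.ofHom (N.submoduleOf K).mkQ
  have hfg : Function.Exact f.hom.hom g.hom.hom := by
    intro y
    refine (Submodule.Quotient.mk_eq_zero _).trans ⟨fun h => ⟨⟨y.1, h⟩, rfl⟩, ?_⟩
    rintro ⟨x, rfl⟩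
    exact x.2
  have w : f ≫ g = 0 := FGModuleCat.hom_ext (LinearMap.ext fun x => hfg.apply_apply_eq_zero x)
  have hf : Mono f := mono_of_injective f (Submodule.inclusion_injective hNK)
  have hg : Epi g := (epi_iff_surjective g).2 (Submodule.mkQ_surjective _)
  refine ⟨ShortComplex.mk f g w, ⟨?_⟩, rfl, rfl, rfl⟩
  have : PreservesFiniteLimits (ModuleCat.isFG A).ι :=
    inferInstanceAs (PreservesFiniteLimits (forget₂ (FGModuleCat A) (ModuleCat A)))
  have : PreservesFiniteColimits (ModuleCat.isFG A).ι :=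
    inferInstanceAs (PreservesFiniteColimits (forget₂ (FGModuleCat A) (ModuleCat A)))
  rw [← ShortComplex.exact_map_iff_of_faithful _ (ModuleCat.isFG A).ι]
  exact (ShortComplex.moduleCat_exact_iff _).2 fun x hx => (hfg x).1 hx

end FGModules

/-! ### Composition factors detected by projective covers -/

section Covers

variable {A : Type u} [Ring A]

/-- `M` receives no nonzero map from the `P i` with `i ∉ S`. -/
def CoverFree {n : ℕ} (P : Fin n → FGModuleCat.{u} A) (S : Set (Fin n))
    (M : FGModuleCat.{u} A) : Prop :=
  ∀ i ∉ S, ∀ f : P i ⟶ M, f = 0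

theorem IsProjectiveCover.isProjective {P L : FGModuleCat.{u} A} {π : P ⟶ L}
    (h : IsProjectiveCover π) : Projective P :=
  have := h.projective
  projective_of_module_projective P

theorem IsProjectiveCover.ne_zero {P L : FGModuleCat.{u} A} {π : P ⟶ L}
    (h : IsProjectiveCover π) (hL : IsSimpleModule A L) : π ≠ 0 := by
  rintro rfl
  have := IsSimpleModule.nontrivial A L
  obtain ⟨x, hx⟩ := exists_ne (0 : L)
  obtain ⟨y, rfl⟩ := h.surjective x
  exact hx rfl

/-- Both kernels are maximal submodules. Were they distinct, their sum would be everything, and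
superfluity would make `ker f` everything. -/
theorem IsProjectiveCover.ker_eq {P L : FGModuleCat.{u} A} {π : P ⟶ L}
    (h : IsProjectiveCover π) (hL : IsSimpleModule A L) {V : Type u} [AddCommGroup V]
    [Module A V] [IsSimpleModule A V] (f : P →ₗ[A] V) (hf : f ≠ 0) :
    LinearMap.ker f = LinearMap.ker π.hom.hom := by
  have hs : Function.Surjective f := LinearMap.surjective_of_ne_zero hf
  have hK : IsCoatom (LinearMap.ker f) := LinearMap.isCoatom_ker_of_surjective hs
  have hK' : IsCoatom (LinearMap.ker π.hom.hom) :=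
    LinearMap.isCoatom_ker_of_surjective h.surjective
  have hne : LinearMap.ker f ⊔ LinearMap.ker π.hom.hom ≠ ⊤ := fun e => hK.1 (h.superfluous _ e)
  rw [← hK.le_iff.1 (le_sup_left) |>.resolve_left hne]
  exact (hK'.le_iff.1 le_sup_right).resolve_left hne

theorem IsProjectiveCover.nonempty_linearEquiv {P L : FGModuleCat.{u} A} {π : P ⟶ L}
    (h : IsProjectiveCover π) (hL : IsSimpleModule A L) {V : Type u} [AddCommGroup V]
    [Module A V] [IsSimpleModule A V] (f : P →ₗ[A] V) (hf : f ≠ 0) : Nonempty (V ≃ₗ[A] L) :=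
  ⟨(f.quotKerEquivOfSurjective (LinearMap.surjective_of_ne_zero hf)).symm ≪≫ₗ
    Submodule.quotEquivOfEq _ _ (h.ker_eq hL f hf) ≪≫ₗ
    π.hom.hom.quotKerEquivOfSurjective h.surjective⟩

/-- If no subfactor is `L`, then `P` has only the zero map to each of them, so the range of `f`
descends the whole series down to `⊥`. -/
theorem IsProjectiveCover.exists_subfactor {P L : FGModuleCat.{u} A} {π : P ⟶ L}
    (h : IsProjectiveCover π) (hL : IsSimpleModule A L) {M : FGModuleCat.{u} A} (f : P ⟶ M)
    (hf : f ≠ 0) (s : CompositionSeries (Submodule A M)) (h0 : s.head = ⊥) (h1 : s.last = ⊤) :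
    ∃ j : Fin s.length, Nonempty (Subfactor s j ≃ₗ[A] L) := by
  by_contra! hs
  refine hf (FGModuleCat.hom_ext (LinearMap.range_eq_bot.1 (le_bot_iff.1 ?_)))
  suffices H : ∀ j, LinearMap.range f.hom.hom ≤ s j from h0 ▸ H 0
  intro j
  induction j using Fin.reverseInduction with
  | last => exact le_top.trans h1.ge
  | cast j ih =>
    have : IsSimpleModule A (Subfactor s j) :=
      (covBy_iff_quot_is_simple (s.step j).le).1 (s.step j)
    by_contra hj
    obtain ⟨_, ⟨x, rfl⟩, hx⟩ := SetLike.not_le_iff_exists.1 hj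
    let g : P →ₗ[A] Subfactor s j := ((s j.castSucc).submoduleOf (s j.succ)).mkQ ∘ₗ
      f.hom.hom.codRestrict (s j.succ) fun x => ih ⟨x, rfl⟩
    refine not_isEmpty_iff.2 (h.nonempty_linearEquiv hL g fun hg => hx ?_) (hs j)
    exact (Submodule.Quotient.mk_eq_zero ((s j.castSucc).submoduleOf (s j.succ))).1
      (LinearMap.congr_fun hg x :)

theorem IsProjectiveCover.exists_ne_zero {P L : FGModuleCat.{u} A} {π : P ⟶ L}
    (h : IsProjectiveCover π) (hL : IsSimpleModule A L) {M : FGModuleCat.{u} A}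
    {N : Submodule A M} {N' : Submodule A N} (e : (N ⧸ N') ≃ₗ[A] L) : ∃ f : P ⟶ M, f ≠ 0 := by
  have := h.projective
  obtain ⟨g, hg⟩ := Module.projective_lifting_property N'.mkQ (e.symm.toLinearMap ∘ₗ π.hom.hom)
    N'.mkQ_surjective
  refine ⟨ObjectProperty.homMk (ModuleCat.ofHom (N.subtype ∘ₗ g)), fun h0 => h.ne_zero hL ?_⟩
  ext x
  have hx : (g x : M) = 0 := LinearMap.congr_fun (congr_arg (fun f => f.hom.hom) h0) x
  have := LinearMap.congr_fun hg x
  rw [LinearMap.comp_apply, show g x = 0 from Subtype.ext hx, map_zero] at this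
  exact (e.symm.map_eq_zero_iff.1 this.symm)

variable {n : ℕ} {L P : Fin n → FGModuleCat.{u} A} {π : ∀ i, P i ⟶ L i} {S : Set (Fin n)}

theorem serre_iff_coverFree [IsArtinianRing A] (hL : IsCompleteSimpleList L)
    (hP : ∀ i, IsProjectiveCover (π i)) (M : FGModuleCat.{u} A) :
    serre L S M ↔ CoverFree P S M := by
  refine ⟨fun h i hi f => ?_, fun h i hi => ?_⟩
  · by_contra hf
    refine hi (h i fun h0 => ?_)
    -- An infimum in `ℕ` is also zero for the empty set; that case is excluded by the existence of a
    -- composition series. Only one series is ever needed, so Jordan–Hölder plays no role.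
    rcases Nat.sInf_eq_zero.1 h0 with ⟨s, hs0, hs1, hs⟩ | he
    · obtain ⟨j, hj⟩ := (hP i).exists_subfactor (hL.simple i) f hf s hs0 hs1
      have : Nonempty {j : Fin s.length // Nonempty (Subfactor s j ≃ₗ[A] L i)} := ⟨⟨j, hj⟩⟩
      exact Nat.card_pos.ne hs
    · obtain ⟨s, hs0, hs1⟩ := exists_compositionSeries_of_isNoetherian_isArtinian A M
      exact (Set.ext_iff.1 he _).1 ⟨s, hs0, hs1, rfl⟩
  · by_contra hiS
    obtain ⟨s, -, -, hs⟩ := Nat.sInf_mem (Nat.nonempty_of_pos_sInf (Nat.pos_of_ne_zero hi))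
    have hne : Nat.card {j : Fin s.length // Nonempty (Subfactor s j ≃ₗ[A] L i)} ≠ 0 := hs ▸ hi
    obtain ⟨⟨j, ⟨e⟩⟩⟩ := (Nat.card_ne_zero.1 hne).1
    obtain ⟨f, hf⟩ := (hP i).exists_ne_zero (hL.simple i) e
    exact hf (h i hiS f)

theorem coverFree_simple (hL : IsCompleteSimpleList L) (hP : ∀ i, IsProjectiveCover (π i))
    {i : Fin n} (hi : i ∈ S) : CoverFree P S (L i) := by
  intro j hj f
  by_contra hf
  have := hL.simple i
  obtain ⟨e⟩ := (hP j).nonempty_linearEquiv (hL.simple j) f.hom.hom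
    fun h => hf (FGModuleCat.hom_ext h)
  exact hj (hL.pairwise i j ⟨e.toFGModuleCatIso⟩ ▸ hi)

end Covers

/-! ### Classes in the Grothendieck group -/

section Grothendieck

variable {C : Type u₁} [Category.{v₁} C] [Abelian C]

theorem K0class_eq_add {T : ShortComplex C} (hT : T.ShortExact) :
    K0class T.X₂ = K0class T.X₁ + K0class T.X₃ := by
  have h : FreeAbelianGroup.of T.X₂ - FreeAbelianGroup.of T.X₁ - FreeAbelianGroup.of T.X₃ ∈
      exactRelations C := AddSubgroup.subset_closure ⟨T, hT, rfl⟩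
  have h' := (QuotientAddGroup.eq_zero_iff _).2 h
  rw [QuotientAddGroup.mk_sub, QuotientAddGroup.mk_sub, sub_sub, sub_eq_zero] at h'
  exact h'

/-- Isomorphism invariance is not among the defining relations; it comes from the sequence `0 ⟶ Z ⟶
X ⟶ Y ⟶ 0`, first with `X = Y = Z` to get `[Z] = 0`. -/
theorem K0class_eq_add_of_isZero {Z X Y : C} (hZ : IsZero Z) (e : X ≅ Y) :
    K0class X = K0class Z + K0class Y :=
  K0class_eq_add (T := ShortComplex.mk (0 : Z ⟶ X) e.hom zero_comp)
    (ShortComplex.Splitting.shortExact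
      { r := 0, s := e.inv, f_r := hZ.eq_of_src _ _, s_g := e.inv_hom_id, id := by simp })

theorem K0class_of_isZero {Z : C} (hZ : IsZero Z) : K0class Z = 0 := by
  simpa using K0class_eq_add_of_isZero hZ (Iso.refl Z)

theorem K0class_congr {X Y : C} (e : X ≅ Y) : K0class X = K0class Y := by
  rw [K0class_eq_add_of_isZero (isZero_zero C) e, K0class_of_isZero (isZero_zero C), zero_add]

variable (k : Type w) [Field k] [Linear k C]

/-- `Hom(P, -)` is exact for projective `P`, so this is rank–nullity. -/
theorem finrank_hom_eq_add (P : C) [Projective P] {T : ShortComplex C} (hT : T.ShortExact)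
    [Module.Finite k (P ⟶ T.X₂)] :
    Module.finrank k (P ⟶ T.X₂) = Module.finrank k (P ⟶ T.X₁) + Module.finrank k (P ⟶ T.X₃) := by
  have := hT.mono_f
  have := hT.epi_g
  let φ := Linear.rightComp k P T.f
  let ψ := Linear.rightComp k P T.g
  have hφ : Function.Injective φ := fun a b h => (cancel_mono T.f).1 h
  have hψ : LinearMap.range ψ = ⊤ := LinearMap.range_eq_top.2 fun a =>
    ⟨Projective.factorThru a T.g, Projective.factorThru_comp a T.g⟩
  have h : LinearMap.ker ψ = LinearMap.range φ := by
    ext a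
    refine ⟨fun ha => ⟨hT.exact.liftFromProjective a ha, hT.exact.liftFromProjective_comp a ha⟩, ?_⟩
    rintro ⟨b, rfl⟩
    simp [φ, ψ]
  have := LinearMap.finrank_range_add_finrank_ker ψ
  rw [hψ, h, finrank_top, LinearMap.finrank_range_of_inj hφ] at this
  rw [← this, add_comm]

/-- The map `[M] ↦ dim Hom(P, M)` for a projective object `P`. -/
def dimHom (P : C) [Projective P] [∀ M, Module.Finite k (P ⟶ M)] : GrothendieckK0 C →+ ℤ :=
  QuotientAddGroup.lift _ (FreeAbelianGroup.lift fun M => (Module.finrank k (P ⟶ M) : ℤ)) <| by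
    rw [exactRelations, AddSubgroup.closure_le]
    rintro _ ⟨T, hT, rfl⟩
    simp [finrank_hom_eq_add k P hT]

theorem dimHom_K0class (P : C) [Projective P] [∀ M, Module.Finite k (P ⟶ M)] (M : C) :
    dimHom k P (K0class M) = Module.finrank k (P ⟶ M) :=
  FreeAbelianGroup.lift_apply_of _ _

end Grothendieck

open scoped ModuleCat in
theorem finite_hom_field (k : Type w) {A : Type u} [Field k] [Ring A] [Algebra k A]
    [Module.Finite k A] (X Y : FGModuleCat.{u} A) : Module.Finite k (X ⟶ Y) := by
  have : Module.Finite k X := Module.Finite.trans A X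
  have : Module.Finite k Y := Module.Finite.trans A Y
  let φ : (X ⟶ Y) →ₗ[k] (X →ₗ[k] Y) :=
    { toFun := fun f => f.hom.hom.restrictScalars k
      map_add' := fun _ _ => rfl
      map_smul' := fun _ _ => rfl }
  exact Module.Finite.of_injective φ fun f g h => by
    ext x
    exact LinearMap.congr_fun h x

/-! ### Membership in `𝒩_S` read off from the Grothendieck group -/

section Preservation

variable {A : Type u} [Ring A] [IsArtinianRing A]
variable {n : ℕ} {L P : Fin n → FGModuleCat.{u} A} {π : ∀ i, P i ⟶ L i} {S : Set (Fin n)}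

/-- The class of a module without maps from the `P i`, `i ∉ S`, is in the span of the `[L i]`
with `i ∈ S`. -/
theorem K0class_mem_classSpan (hL : IsCompleteSimpleList L)
    (hP : ∀ i, IsProjectiveCover (π i)) {M : FGModuleCat.{u} A} (hM : CoverFree P S M) :
    K0class M ∈ classSpan L S := by
  suffices H : ∀ N : Submodule A M, K0class (FGModuleCat.of A N) ∈ classSpan L S by
    have e : FGModuleCat.of A (⊤ : Submodule A M) ≅ M :=
      (Submodule.topEquiv (R := A) (M := M)).toFGModuleCatIso
    exact K0class_congr e ▸ H ⊤
  intro N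
  induction N using WellFoundedLT.induction with
  | ind N ih =>
    rcases eq_or_ne N ⊥ with rfl | hN
    · have hZ : IsZero (FGModuleCat.of A (⊥ : Submodule A M)) :=
        (IsZero.iff_id_eq_zero _).2
          (FGModuleCat.hom_ext (LinearMap.ext fun x => Subsingleton.elim _ _))
      rw [K0class_of_isZero hZ]
      exact zero_mem _
    -- Peel off a simple top `N / K ≅ L i`. Here `i ∈ S`, since otherwise `P i` would map
    -- nontrivially to `M`.
    · obtain ⟨K, -, hK⟩ := exists_le_covBy_of_lt (bot_lt_iff_ne_bot.2 hN)
      obtain ⟨T, hT, h1, h2, h3⟩ := exists_shortExact_of_le hK.le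
      have : IsSimpleModule A (N ⧸ K.submoduleOf N) := (covBy_iff_quot_is_simple hK.le).1 hK
      obtain ⟨i, ⟨e⟩⟩ := hL.complete (FGModuleCat.of A (N ⧸ K.submoduleOf N)) this
      have hi : i ∈ S := by
        by_contra hi
        obtain ⟨f, hf⟩ := (hP i).exists_ne_zero (hL.simple i) (FGModuleCat.isoToLinearEquiv e)
        exact hf (hM i hi f)
      rw [← h2, K0class_eq_add hT, h1, h3, K0class_congr e]
      exact add_mem (ih K hK.lt) (Submodule.subset_span ⟨i, hi, rfl⟩)

/-- For the converse, `dim Hom(P j, -)` with `j ∉ S` vanishes on every `[L i]`, `i ∈ S`, hence on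
their span; a hom space of dimension zero is zero. -/
theorem coverFree_iff_mem_classSpan (k : Type w) [Field k] [Algebra k A] [Module.Finite k A]
    (hL : IsCompleteSimpleList L)
    (hP : ∀ i, IsProjectiveCover (π i)) (M : FGModuleCat.{u} A) :
    CoverFree P S M ↔ K0class M ∈ classSpan L S := by
  refine ⟨K0class_mem_classSpan hL hP, fun h j hj f => ?_⟩
  have : ∀ M, Module.Finite k (P j ⟶ M) := finite_hom_field k _
  have := (hP j).isProjective
  have hle : classSpan L S ≤ (dimHom k (P j)).toIntLinearMap.ker := by
    refine Submodule.span_le.2 ?_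
    rintro _ ⟨i, hi, rfl⟩
    have : Subsingleton (P j ⟶ L i) :=
      subsingleton_of_forall_eq 0 (coverFree_simple hL hP hi j hj)
    exact (dimHom_K0class k _ _).trans (by simp [Module.finrank_zero_of_subsingleton])
  have h0 : (Module.finrank k (P j ⟶ M) : ℤ) = 0 := (dimHom_K0class k _ _).symm.trans (hle h)
  have := Module.finrank_zero_iff.1 (Int.natCast_eq_zero.1 h0)
  exact Subsingleton.elim _ _

theorem coverFree_map (k : Type w) [Field k] [Algebra k A] [Module.Finite k A]
    (hL : IsCompleteSimpleList L) (hP : ∀ i, IsProjectiveCover (π i))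
    (F : FGModuleCat.{u} A ⥤ FGModuleCat.{u} A) [F.Additive]
    (hF : ∀ T : ShortComplex (FGModuleCat.{u} A), T.ShortExact → (T.map F).ShortExact)
    (hinv : ∀ x ∈ classSpan L S, K0map F hF x ∈ classSpan L S)
    {M : FGModuleCat.{u} A} (hM : CoverFree P S M) : CoverFree P S (F.obj M) := by
  rw [coverFree_iff_mem_classSpan k hL hP] at hM ⊢
  exact hinv _ hM

end Preservation

/-! ### The additive closure of a sum of projective covers -/

section AddClosure

variable {C : Type u₁} [Category.{v₁} C] [Preadditive C] [HasFiniteBiproducts C]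

/-- The identity of an object of `add X` is a sum of maps that factor through `X`. -/
theorem addClosure.exists_sum_eq_id {X Y : C} (h : addClosure X Y) :
    ∃ (m : ℕ) (a : Fin m → (Y ⟶ X)) (b : Fin m → (X ⟶ Y)), ∑ j, a j ≫ b j = 𝟙 Y := by
  obtain ⟨m, Z, hZ, ⟨e⟩⟩ := h
  refine ⟨m, fun j => e.hom ≫ biproduct.π Z j ≫ (hZ j).some.i,
    fun j => (hZ j).some.r ≫ biproduct.ι Z j ≫ e.inv, ?_⟩
  have : ∀ j, (e.hom ≫ biproduct.π Z j ≫ (hZ j).some.i) ≫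
      (hZ j).some.r ≫ biproduct.ι Z j ≫ e.inv =
      e.hom ≫ (biproduct.π Z j ≫ biproduct.ι Z j) ≫ e.inv := fun j => by simp
  simp_rw [this, ← Preadditive.comp_sum, ← Preadditive.sum_comp, biproduct.total]
  simp

theorem addClosure.projective {X Y : C} [Projective X] (h : addClosure X Y) : Projective Y where
  factors {E Z} f e he := by
    obtain ⟨m, a, b, hab⟩ := h.exists_sum_eq_id
    refine ⟨∑ j, a j ≫ Projective.factorThru (b j ≫ f) e, ?_⟩
    simp_rw [Preadditive.sum_comp, Category.assoc, Projective.factorThru_comp, ← Category.assoc,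
      ← Preadditive.sum_comp, hab, Category.id_comp]

theorem addClosure.eq_zero {X Y Z : C} (h : addClosure X Y) (hX : ∀ f : X ⟶ Z, f = 0)
    (f : Y ⟶ Z) : f = 0 := by
  obtain ⟨m, a, b, hab⟩ := h.exists_sum_eq_id
  rw [← Category.id_comp f, ← hab, Preadditive.sum_comp]
  exact Finset.sum_eq_zero fun j _ => by rw [Category.assoc, hX (b j ≫ f), Limits.comp_zero]

theorem addClosure_of_isZero (X : C) {Y : C} (hY : IsZero Y) : addClosure X Y := by
  refine ⟨0, Fin.elim0, fun j => j.elim0, ⟨hY.iso ?_⟩⟩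
  exact (IsZero.iff_id_eq_zero _).2 (biproduct.hom_ext _ _ fun j => j.elim0)

/-- `add X` contains the middle term of a split short exact sequence with a first term in `add X`
and a third term that is a direct summand of `X`. -/
theorem addClosure.of_splitting {X : C} {T : ShortComplex C} (σ : T.Splitting)
    (h₁ : addClosure X T.X₁) (h₃ : Retract T.X₃ X) : addClosure X T.X₂ := by
  obtain ⟨m, Z, hZ, ⟨e⟩⟩ := h₁
  let W : Fin (m + 1) → C := Fin.cons T.X₃ Z
  let p : ∀ j, T.X₂ ⟶ W j := Fin.cons T.g fun j => σ.r ≫ e.hom ≫ biproduct.π Z j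
  let i : ∀ j, W j ⟶ T.X₂ := Fin.cons σ.s fun j => biproduct.ι Z j ≫ e.inv ≫ T.f
  have hip : ∀ j, i j ≫ p j = 𝟙 (W j) := by
    refine Fin.cases σ.s_g fun j => ?_
    change (biproduct.ι Z j ≫ e.inv ≫ T.f) ≫ σ.r ≫ e.hom ≫ biproduct.π Z j = 𝟙 (Z j)
    simp
  have hip' : ∀ j j', j ≠ j' → i j ≫ p j' = 0 := by
    intro j j' hj
    induction j using Fin.cases with
    | zero => induction j' using Fin.cases with
      | zero => exact absurd rfl hj
      | succ j' =>
        change σ.s ≫ σ.r ≫ e.hom ≫ biproduct.π Z j' = 0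
        rw [σ.s_r_assoc, Limits.zero_comp]
    | succ j => induction j' using Fin.cases with
      | zero =>
        change (biproduct.ι Z j ≫ e.inv ≫ T.f) ≫ T.g = 0
        simp
      | succ j' =>
        change (biproduct.ι Z j ≫ e.inv ≫ T.f) ≫ σ.r ≫ e.hom ≫ biproduct.π Z j' = 0
        simp [biproduct.ι_π_ne _ fun h : j = j' => hj (h ▸ rfl)]
  have htot : ∑ j, p j ≫ i j = 𝟙 T.X₂ := by
    rw [Fin.sum_univ_succ]
    have h (j : Fin m) : p j.succ ≫ i j.succ =
        (σ.r ≫ e.hom) ≫ (biproduct.π Z j ≫ biproduct.ι Z j) ≫ e.inv ≫ T.f := by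
      change (σ.r ≫ e.hom ≫ biproduct.π Z j) ≫ biproduct.ι Z j ≫ e.inv ≫ T.f = _
      simp only [Category.assoc]
    simp_rw [h, ← Preadditive.comp_sum, ← Preadditive.sum_comp, biproduct.total]
    rw [Category.id_comp, Category.assoc, e.hom_inv_id_assoc, add_comm]
    exact σ.id
  let b : Limits.Bicone W :=
    { pt := T.X₂
      π := p
      ι := i
      ι_π := fun j j' => by
        split_ifs with h
        · subst h
          simpa using hip j
        · exact hip' j j' h }
  exact ⟨m + 1, W, Fin.cases ⟨h₃⟩ hZ, ⟨biproduct.uniqueUpToIso W (isBilimitOfTotal b htot)⟩⟩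

theorem addClosure_self_sum (X : C) (m : ℕ) : addClosure X (⨁ fun _ : Fin m => X) :=
  ⟨m, fun _ => X, fun _ => ⟨Retract.refl X⟩, ⟨Iso.refl _⟩⟩

end AddClosure

section Covers

variable {A : Type u} [Ring A] {n : ℕ} {L P : Fin n → FGModuleCat.{u} A} {π : ∀ i, P i ⟶ L i}
  {S : Set (Fin n)}

theorem coverFree_iff_coverSum (M : FGModuleCat.{u} A) :
    CoverFree P S M ↔ ∀ f : coverSum P Sᶜ ⟶ M, f = 0 := by
  refine ⟨fun h f => biproduct.hom_ext' _ _ fun i => (h i i.2 _).trans Limits.comp_zero.symm,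
    fun h i hi f => ?_⟩
  exact (cancel_epi (biproduct.π (fun i : ↥Sᶜ => P i) ⟨i, hi⟩)).1
    ((h _).trans Limits.comp_zero.symm)

theorem projective_coverSum (hP : ∀ i, IsProjectiveCover (π i)) (T : Set (Fin n)) :
    Projective (coverSum P T) where
  factors {E X} f e he := by
    have : ∀ i : T, Projective (P i) := fun i => (hP i).isProjective
    refine ⟨biproduct.desc fun i : T =>
      Projective.factorThru (biproduct.ι (fun i : T => P i) i ≫ f) e, ?_⟩
    exact biproduct.hom_ext' _ _ fun i =>
      (biproduct.ι_desc_assoc _ i e).trans (Projective.factorThru_comp _ _)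

/-- The summand `P i` as a retract of `P_T`, for `i ∈ T`. -/
def retractCoverSum (P : Fin n → FGModuleCat.{u} A) {T : Set (Fin n)} {i : Fin n} (hi : i ∈ T) :
    Retract (P i) (coverSum P T) where
  i := biproduct.ι (fun i : T => P i) ⟨i, hi⟩
  r := biproduct.π (fun i : T => P i) ⟨i, hi⟩
  retract := biproduct.ι_π_self _ _

variable [IsArtinianRing A]

/-- The modules in `add P_{S'}` are the projective modules without maps to the `L i`, `i ∈ S`. -/
theorem addClosure_coverSum_iff (hL : IsCompleteSimpleList L) (hP : ∀ i, IsProjectiveCover (π i))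
    (X : FGModuleCat.{u} A) :
    addClosure (coverSum P Sᶜ) X ↔ Projective X ∧ ∀ i ∈ S, ∀ f : X ⟶ L i, f = 0 := by
  have := projective_coverSum hP Sᶜ
  refine ⟨fun h => ⟨h.projective, fun i hi f => h.eq_zero
    ((coverFree_iff_coverSum _).1 (coverFree_simple hL hP hi)) f⟩, ?_⟩
  induction hl : Module.length A X using WellFoundedLT.induction generalizing X with
  | ind l ih =>
  rintro ⟨hX, h0⟩
  rcases subsingleton_or_nontrivial X with hs | hs
  · exact addClosure_of_isZero _ ((IsZero.iff_id_eq_zero _).2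
      (FGModuleCat.hom_ext (LinearMap.ext fun x => Subsingleton.elim _ _)))
  -- A simple quotient `L i` of `X` has `i ∉ S` by hypothesis. It will be shown that `P i` splits
  -- off `X`, leaving a shorter complement of the same kind.
  obtain ⟨N, hN⟩ := IsCoatomic.exists_coatom (Submodule A X)
  have : IsSimpleModule A (X ⧸ N) := isSimpleModule_iff_isCoatom.2 hN
  obtain ⟨i, ⟨e⟩⟩ := hL.complete (FGModuleCat.of A (X ⧸ N)) this
  let q : X ⟶ L i := (FGModuleCat.ofHom N.mkQ : X ⟶ FGModuleCat.of A (X ⧸ N)) ≫ e.hom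
  have hq : Epi q := by
    have : Epi (FGModuleCat.ofHom N.mkQ : X ⟶ FGModuleCat.of A (X ⧸ N)) :=
      (epi_iff_surjective _).2 N.mkQ_surjective
    exact epi_comp _ _
  have hi : i ∉ S := fun hi => by
    refine (hP i).ne_zero (hL.simple i) ?_
    have h1 : 𝟙 (L i) = 0 := (cancel_epi q).1 ((h0 i hi _).trans (h0 i hi _).symm)
    rw [← Category.comp_id (π i), h1, Limits.comp_zero]
  have := (hP i).isProjective
  have hπ : Epi (π i) := (epi_iff_surjective _).2 (hP i).surjective
  let r : X ⟶ P i := Projective.factorThru q (π i)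
  have hr : r ≫ π i = q := Projective.factorThru_comp _ _
  -- The range of `r` together with `ker (π i)` is all of `P i`, because `q` is onto; superfluity of
  -- the kernel finishes.
  have hrs : Epi r := by
    refine (epi_iff_surjective _).2 (LinearMap.range_eq_top.1 ((hP i).superfluous _ ?_))
    refine eq_top_iff.2 fun y _ => ?_
    obtain ⟨x, hx⟩ := (epi_iff_surjective _).1 hq ((π i).hom.hom y)
    rw [← hr] at hx
    rw [← add_sub_cancel (r.hom.hom x) y]
    refine Submodule.add_mem_sup ⟨x, rfl⟩ ?_
    rw [LinearMap.mem_ker, map_sub, sub_eq_zero]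
    exact hx.symm
  let s : P i ⟶ X := Projective.factorThru (𝟙 _) r
  let T : ShortComplex (FGModuleCat.{u} A) := ShortComplex.mk (kernel.ι r) r (kernel.condition r)
  let σ : T.Splitting := ShortComplex.Splitting.ofExactOfSection T
    (ShortComplex.exact_of_f_is_kernel _ (kernelIsKernel r)) s (Projective.factorThru_comp _ _)
    (inferInstanceAs (Mono (kernel.ι r)))
  refine addClosure.of_splitting σ (ih _ ?_ (kernel r) rfl ⟨?_, fun j hj f => ?_⟩)
    (retractCoverSum P hi)
  · subst hl
    have hinj : Function.Injective (kernel.ι r).hom.hom :=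
      (ModuleCat.mono_iff_injective _).1
        (inferInstanceAs (Mono ((forget₂ (FGModuleCat A) (ModuleCat A)).map (kernel.ι r))))
    rw [(LinearEquiv.ofInjective _ hinj).length_eq]
    -- The kernel is proper: otherwise `r = 0`, and then `π i = 0` because `r` is epi.
    refine Submodule.length_lt fun htop => ?_
    have : Epi (kernel.ι r) := (epi_iff_surjective _).2 (LinearMap.range_eq_top.1 htop)
    have hr0 : r = 0 := by rw [← cancel_epi (kernel.ι r), kernel.condition, Limits.comp_zero]
    refine (hP i).ne_zero (hL.simple i) ?_
    rw [← cancel_epi r, hr0, Limits.zero_comp, Limits.zero_comp]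
  · exact Retract.projective ⟨T.f, σ.r, σ.f_r⟩
  · have := h0 j hj (σ.r ≫ f)
    rw [← Category.id_comp f, ← σ.f_r, Category.assoc, this, Limits.comp_zero]

/-- An exact selfadjoint functor that preserves the modules without maps from the `P i`, `i ∉ S`,
preserves the additive closure of these `P i`. -/
theorem addClosure_map (hL : IsCompleteSimpleList L) (hP : ∀ i, IsProjectiveCover (π i))
    {F : FGModuleCat.{u} A ⥤ FGModuleCat.{u} A} (adj : F ⊣ F)
    (hF : ∀ M, CoverFree P S M → CoverFree P S (F.obj M)) {X : FGModuleCat.{u} A}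
    (hX : addClosure (coverSum P Sᶜ) X) : addClosure (coverSum P Sᶜ) (F.obj X) := by
  have := projective_coverSum hP Sᶜ
  have := adj.isLeftAdjoint
  -- The right adjoint of `F`, being `F` itself, preserves epimorphisms, so `F` preserves
  -- projectives.
  refine (addClosure_coverSum_iff hL hP _).2 ⟨adj.map_projective X hX.projective, fun i hi f => ?_⟩
  refine (adj.homEquiv X (L i)).injective ?_
  have h := hX.eq_zero ((coverFree_iff_coverSum _).1 (hF _ (coverFree_simple hL hP hi)))
  rw [h (adj.homEquiv X (L i) f), h (adj.homEquiv X (L i) 0)]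

theorem presentable_map (hL : IsCompleteSimpleList L) (hP : ∀ i, IsProjectiveCover (π i))
    {F : FGModuleCat.{u} A ⥤ FGModuleCat.{u} A} [F.Additive] (adj : F ⊣ F)
    (hF : ∀ M, CoverFree P S M → CoverFree P S (F.obj M)) {Y : FGModuleCat.{u} A}
    (hY : presentable (coverSum P Sᶜ) Y) : presentable (coverSum P Sᶜ) (F.obj Y) := by
  obtain ⟨X₁, X₀, f, g, hfg, h₁, h₀, hex, hg⟩ := hY
  have := adj.rightAdjoint_preservesLimits
  have := adj.leftAdjoint_preservesColimits
  have : PreservesFiniteLimits F := PreservesLimits.preservesFiniteLimits F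
  have : PreservesFiniteColimits F := PreservesColimits.preservesFiniteColimits F
  exact ⟨F.obj X₁, F.obj X₀, F.map f, F.map g, by rw [← F.map_comp, hfg, F.map_zero],
    addClosure_map hL hP adj hF h₁, addClosure_map hL hP adj hF h₀, hex.map F, inferInstance⟩

end Covers

/-! ### Polynomials in conjugate functors -/

section Transport

variable {C : Type u₁} [Category.{v₁} C] {D : Type u₂} [Category.{v₂} D]

/-- If `G ⋙ E ≅ E ⋙ F`, then the same holds for the powers of `G` and `F`. -/
def iterateIso {E : D ⥤ C} {G : D ⥤ D} {F : C ⥤ C} (e : G ⋙ E ≅ E ⋙ F) :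
    ∀ m, iterate G m ⋙ E ≅ E ⋙ iterate F m
  | 0 => E.leftUnitor ≪≫ E.rightUnitor.symm
  | m + 1 => Functor.associator _ _ _ ≪≫ Functor.isoWhiskerLeft _ e ≪≫
      (Functor.associator _ _ _).symm ≪≫ Functor.isoWhiskerRight (iterateIso e m) F ≪≫
      Functor.associator _ _ _

variable [Preadditive C] [HasFiniteBiproducts C] [Preadditive D] [HasFiniteBiproducts D]

section

variable {J : Type} [Finite J] (E : D ⥤ C) [E.Additive] {G : J → D ⥤ D} {F : J → C ⥤ C}
  (e : ∀ j, G j ⋙ E ≅ E ⋙ F j)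

/-- The comparison of an additive functor with direct sums of endofunctors, on an object. -/
def directSumIsoApp (M : D) : E.obj (⨁ fun j => (G j).obj M) ≅ ⨁ fun j => (F j).obj (E.obj M) :=
  E.mapBiproduct (fun j => (G j).obj M) ≪≫ biproduct.mapIso fun j => (e j).app M

theorem directSumIsoApp_hom_π (M : D) (j : J) :
    (directSumIsoApp E e M).hom ≫ biproduct.π (fun j => (F j).obj (E.obj M)) j =
      E.map (biproduct.π (fun j => (G j).obj M) j) ≫ (e j).hom.app M := by
  rw [directSumIsoApp, Iso.trans_hom, Category.assoc, biproduct.mapIso_hom]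
  refine (congr_arg _ (biproduct.map_π _ j)).trans ?_
  rw [← Category.assoc, Functor.mapBiproduct_hom]
  exact congr_arg (· ≫ _) (biproduct.lift_π _ j)

theorem directSumIsoApp_naturality {M N : D} (f : M ⟶ N) :
    E.map (biproduct.map fun j => (G j).map f) ≫ (directSumIsoApp E e N).hom =
      (directSumIsoApp E e M).hom ≫ biproduct.map fun j => (F j).map (E.map f) := by
  refine biproduct.hom_ext _ _ fun j => ?_
  have : E.map ((G j).map f) ≫ (e j).hom.app N = (e j).hom.app M ≫ (F j).map (E.map f) :=
    (e j).hom.naturality f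
  rw [Category.assoc, Category.assoc, directSumIsoApp_hom_π, biproduct.map_π, ← Category.assoc,
    ← E.map_comp, biproduct.map_π, E.map_comp, Category.assoc, this, ← Category.assoc,
    ← Category.assoc, directSumIsoApp_hom_π]

/-- An additive functor commutes with direct sums of endofunctors. -/
def directSumIso : directSum G ⋙ E ≅ E ⋙ directSum F :=
  NatIso.ofComponents (directSumIsoApp E e) fun f => directSumIsoApp_naturality E e f

end

/-- The functor `E` intertwines all powers and direct sums, so `g(G) ⋙ E ≅ E ⋙ g(F) ≅ E ⋙ h(F) ≅
h(G) ⋙ E`, and a fully faithful `E` cancels. No equivalence is needed, so one lemma serves both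
induced functors. -/
theorem nonempty_polyFunctor_iso {E : D ⥤ C} [E.Additive] [E.Full] [E.Faithful] {G : D ⥤ D}
    {F : C ⥤ C} (e : G ⋙ E ≅ E ⋙ F) (g h : ℕ[X])
    (i : Nonempty (polyFunctor g F ≅ polyFunctor h F)) :
    Nonempty (polyFunctor g G ≅ polyFunctor h G) :=
  ⟨Functor.fullyFaithfulCancelRight E (directSumIso E (fun _ => iterateIso e _) ≪≫
    Functor.isoWhiskerLeft E i.some ≪≫ (directSumIso E fun _ => iterateIso e _).symm)⟩

end Transport

/-! ### Restricted and conjugate functors -/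

section Conjugate

variable {C : Type u₁} [Category.{v₁} C] {D : Type u₂} [Category.{v₂} D]

theorem IsSelfadjointFunctor.restrict {F : C ⥤ C} (hF : IsSelfadjointFunctor F)
    (Q : ObjectProperty C) (hQ : ∀ X, Q X → Q (F.obj X)) :
    IsSelfadjointFunctor (restrict Q F hQ) :=
  ⟨hF.some.restrictFullyFaithful Q.fullyFaithfulι Q.fullyFaithfulι (Iso.refl _) (Iso.refl _)⟩

theorem IsSelfadjointFunctor.conjugate {F : C ⥤ C} (hF : IsSelfadjointFunctor F) (e : D ≌ C) :
    IsSelfadjointFunctor (e.functor ⋙ F ⋙ e.inverse) :=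
  ⟨(e.toAdjunction.comp (hF.some.comp e.symm.toAdjunction)).ofNatIsoRight
    (Functor.associator _ _ _)⟩

variable [Preadditive C]

instance restrict_additive (Q : ObjectProperty C) (F : C ⥤ C) [F.Additive]
    (hQ : ∀ X, Q X → Q (F.obj X)) : (restrict Q F hQ).Additive where
  map_add := ObjectProperty.hom_ext _ (F.map_add)

instance restrict_linear (k : Type w) [Ring k] [Linear k C] (Q : ObjectProperty C) (F : C ⥤ C)
    [F.Additive] [F.Linear k] (hQ : ∀ X, Q X → Q (F.obj X)) : (restrict Q F hQ).Linear k where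
  map_smul f r := ObjectProperty.hom_ext _ (F.map_smul r f.hom)

end Conjugate

/-! ### Modules over the quotient by a trace ideal -/

section Quotient

variable {A : Type u} [Ring A]

section Restrict

variable (I : Ideal A) [I.IsTwoSided]

instance : (quotientRestrict I).Faithful where
  map_injective {X Y f g} h := by
    refine FGModuleCat.hom_ext (LinearMap.ext fun x => ?_)
    exact congr_arg (fun g : (quotientRestrict I).obj X ⟶ (quotientRestrict I).obj Y =>
      g.hom.hom x) h

instance : (quotientRestrict I).Full where
  map_surjective {X Y} f := by
    let g : (quotientRestrict I).obj X →ₗ[A] (quotientRestrict I).obj Y := f.hom.hom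
    refine ⟨ObjectProperty.homMk (ModuleCat.ofHom
      { toFun := fun x => show Y from g x
        map_add' := fun x y => g.map_add x y
        map_smul' := fun a x => ?_ }), rfl⟩
    -- `A → A ⧸ I` is onto, so linearity over `A` is linearity over the quotient.
    obtain ⟨a, rfl⟩ := Ideal.Quotient.mk_surjective a
    exact LinearMap.map_smul g a x

instance : (quotientRestrict I).Additive where
  map_add := rfl

instance quotientRestrict_linear (k : Type w) [Field k] [Algebra k A] :
    (quotientRestrict I).Linear k where
  map_smul _ _ := rfl

theorem smul_quotientRestrict_obj (M : FGModuleCat.{u} (A ⧸ I)) {a : A} (ha : a ∈ I)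
    (x : (quotientRestrict I).obj M) : a • x = 0 := by
  change (Ideal.Quotient.mk I a) • (show M from x) = 0
  rw [Ideal.Quotient.eq_zero_iff_mem.2 ha, zero_smul]

theorem exists_quotientRestrict_iso (M : FGModuleCat.{u} A)
    (hM : ∀ a ∈ I, ∀ x : M, a • x = 0) :
    ∃ N, Nonempty ((quotientRestrict I).obj N ≅ M) := by
  have ht : Module.IsTorsionBySet A M I := fun x a => hM a a.2 x
  let := ht.module
  have : IsScalarTower A (A ⧸ I) M := ht.isScalarTower
  have : Module.Finite (A ⧸ I) M := Module.Finite.of_restrictScalars_finite A _ _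
  let N := FGModuleCat.of (A ⧸ I) M
  let e : (quotientRestrict I).obj N ≃ₗ[A] M :=
    { AddEquiv.refl M with map_smul' := fun _ _ => rfl }
  exact ⟨N, ⟨e.toFGModuleCatIso⟩⟩

end Restrict

theorem hom_eq_zero_iff_traceIdeal (X : FGModuleCat.{u} A) [Module.Projective A X]
    (M : FGModuleCat.{u} A) :
    (∀ f : X ⟶ M, f = 0) ↔ ∀ a ∈ traceIdeal X, ∀ x : M, a • x = 0 := by
  constructor
  · intro h a ha x
    have hle : traceIdeal X ≤ LinearMap.ker (LinearMap.toSpanSingleton A M x) := by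
      refine iSup_le fun f => ?_
      rintro _ ⟨y, rfl⟩
      let g : X ⟶ M :=
        ObjectProperty.homMk (ModuleCat.ofHom ((LinearMap.toSpanSingleton A M x).comp f))
      exact LinearMap.congr_fun (congr_arg (fun f => f.hom.hom) (h g)) y
    exact hle ha
  · intro h f
    refine FGModuleCat.hom_ext (LinearMap.ext fun x => ?_)
    -- Dual basis argument: the section `s` writes `x` as a combination of elements `y` with
    -- coefficients `s x y`. Each coordinate of `s` is a map `X → A`, so the coefficients lie in the
    -- trace ideal and annihilate `f y`.
    obtain ⟨s, hs⟩ := Module.projective_def.1 ‹Module.Projective A X›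
    rw [← hs x, Finsupp.linearCombination_apply, Finsupp.sum, map_sum]
    refine (Finset.sum_eq_zero fun y _ => ?_)
    rw [map_smul]
    exact h _ (Submodule.mem_iSup_of_mem (Finsupp.lapply y ∘ₗ s) ⟨x, rfl⟩) _

end Quotient

/-! ### The equivalence of presentable modules with modules over the centralizer algebra -/

section Presentable

variable (k : Type w) {A : Type u} [Field k] [Ring A] [Algebra k A] [Module.Finite k A]
  (X : FGModuleCat.{u} A)

instance homFunctor_additive : (homFunctor k X).Additive where
  map_add {_ _ f g} :=
    FGModuleCat.hom_ext (LinearMap.ext fun t => Preadditive.comp_add _ _ _ t f g)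

instance homFunctor_linear : (homFunctor k X).Linear k where
  -- A scalar `c` acts on an `End(X)ᵒᵖ`-module through `c • 𝟙 X`.
  map_smul {Y _} f c := FGModuleCat.hom_ext (LinearMap.ext fun (t : X ⟶ Y) =>
    ((Linear.comp_smul _ _ _ t c f).trans (by simp) :
      t ≫ (c • f) = (c • 𝟙 X) ≫ t ≫ f))

variable {k X} in
/-- A morphism of finitely generated `End(X)ᵒᵖ`-modules between `Hom` modules is compatible with
the composition of morphisms. -/
theorem homFunctor_hom_comp {Y Z : FGModuleCat.{u} A}
    (φ : (homFunctor k X).obj Y ⟶ (homFunctor k X).obj Z) (c : X ⟶ X) (t : X ⟶ Y) :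
    (show X ⟶ Z from φ.hom.hom (c ≫ t)) = c ≫ (show X ⟶ Z from φ.hom.hom t) :=
  φ.hom.hom.map_smul (MulOpposite.op (show End X from c)) t

variable {k X} in
-- Write `𝟙 X₀ = ∑ a j ≫ b j` through `X`. Then `t = ∑ (t ≫ a j) ≫ b j` with `t ≫ a j` in `End X`,
-- so equivariance determines `φ` from the values `φ (b j)`.
theorem exists_hom_of_addClosure {X₀ Z : FGModuleCat.{u} A} (h : addClosure X X₀)
    (φ : (X ⟶ X₀) →+ (X ⟶ Z)) (hφ : ∀ (c : X ⟶ X) t, φ (c ≫ t) = c ≫ φ t) :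
    ∃ u : X₀ ⟶ Z, ∀ t, φ t = t ≫ u := by
  obtain ⟨m, a, b, hab⟩ := h.exists_sum_eq_id
  refine ⟨∑ j, a j ≫ φ (b j), fun t => ?_⟩
  conv_lhs => rw [← Category.comp_id t, ← hab, Preadditive.comp_sum, map_sum]
  rw [Preadditive.comp_sum]
  exact Finset.sum_congr rfl fun j _ => by rw [← Category.assoc, hφ, Category.assoc]

theorem hom_ext_of_addClosure {X₀ Z : FGModuleCat.{u} A} (h : addClosure X X₀) {u v : X₀ ⟶ Z}
    (huv : ∀ t : X ⟶ X₀, t ≫ u = t ≫ v) : u = v := by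
  obtain ⟨m, a, b, hab⟩ := h.exists_sum_eq_id
  rw [← Category.id_comp u, ← Category.id_comp v, ← hab, Preadditive.sum_comp,
    Preadditive.sum_comp]
  exact Finset.sum_congr rfl fun j _ => by rw [Category.assoc, huv, Category.assoc]

instance presentable_homFunctor_faithful : ((presentable X).ι ⋙ homFunctor k X).Faithful where
  map_injective {Y Z f g} h := by
    obtain ⟨X₁, X₀, p, q, hpq, h₁, h₀, hex, hq⟩ := Y.property
    refine ObjectProperty.hom_ext _ ((cancel_epi q).1 (hom_ext_of_addClosure X h₀ fun t => ?_))
    have := congr_arg (fun φ : (homFunctor k X).obj Y.obj ⟶ (homFunctor k X).obj Z.obj =>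
      φ.hom.hom (t ≫ q)) h
    rw [← Category.assoc, ← Category.assoc]
    exact this

variable [IsArtinianRing A] [Projective X]

instance presentable_homFunctor_full : ((presentable X).ι ⋙ homFunctor k X).Full where
  map_surjective {Y Z} φ := by
    obtain ⟨X₁, X₀, p, q, hpq, h₁, h₀, hex, hq⟩ := Y.property
    let ψ : (X ⟶ Y.obj) →+ (X ⟶ Z.obj) := AddMonoidHom.mk' (fun t => φ.hom.hom t)
      fun s t => φ.hom.hom.map_add s t
    have hψ : ∀ (c : X ⟶ X) t, ψ (c ≫ t) = c ≫ ψ t :=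
      homFunctor_hom_comp (k := k) (Y := Y.obj) (Z := Z.obj) φ
    -- Realize `φ` precomposed with `q` by a map `u` out of `X₀`; it kills the image of `X₁`, hence
    -- descends to the cokernel `Y`. Projectivity of `X` lifts every `X ⟶ Y` to `X₀`.
    obtain ⟨u, hu⟩ := exists_hom_of_addClosure h₀
      (ψ.comp (AddMonoidHom.mk' (fun t : X ⟶ X₀ => t ≫ q)
        fun s t => Preadditive.add_comp _ _ _ s t q))
      fun c t => by simpa using hψ c (t ≫ q)
    replace hu : ∀ t, ψ (t ≫ q) = t ≫ u := hu
    have hpu : p ≫ u = 0 := hom_ext_of_addClosure X h₁ fun t => by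
      rw [← Category.assoc, ← hu, Category.assoc, hpq, Limits.comp_zero, Limits.comp_zero,
        map_zero]
    obtain ⟨v, hv⟩ := CokernelCofork.IsColimit.desc' hex.gIsCokernel u hpu
    refine ⟨ObjectProperty.homMk v, FGModuleCat.hom_ext (LinearMap.ext fun (t : X ⟶ Y.obj) => ?_)⟩
    change t ≫ v = ψ t
    obtain ⟨s, rfl⟩ : ∃ s, s ≫ q = t := ⟨_, Projective.factorThru_comp t q⟩
    rw [hu, ← hv, Category.assoc]
    rfl

instance presentable_homFunctor_essSurj : ((presentable X).ι ⋙ homFunctor k X).EssSurj where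
  mem_essImage M := by
    have : Module.Finite k (End X) := finite_hom_field k X X
    have : Module.Finite k (End X)ᵐᵒᵖ := Module.Finite.equiv
      (MulOpposite.opLinearEquiv k : End X ≃ₗ[k] (End X)ᵐᵒᵖ)
    have : IsNoetherianRing (End X)ᵐᵒᵖ := IsNoetherianRing.of_finite k _
    -- Present `M` by free modules of ranks `m` and `n`, reading the relations `r` as a matrix `p :
    -- X^m ⟶ X^n`. The cokernel of `p` is the required preimage.
    obtain ⟨n, β, hβ⟩ := Module.Finite.exists_fin' (End X)ᵐᵒᵖ M
    obtain ⟨m, r, hr⟩ := Submodule.fg_iff_exists_fin_generating_family.1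
      (IsNoetherian.noetherian (LinearMap.ker β))
    let Q (l : ℕ) : FGModuleCat.{u} A := ⨁ fun _ : Fin l => X
    let p : Q m ⟶ Q n := biproduct.matrix fun l j => (r l j).unop
    let κ {l : ℕ} : (X ⟶ Q l) →ₗ[(End X)ᵐᵒᵖ] (Fin l → (End X)ᵐᵒᵖ) :=
      { toFun := fun t j => MulOpposite.op (t ≫ biproduct.π (fun _ : Fin l => X) j : X ⟶ X)
        map_add' := fun s t => funext fun j => congr_arg MulOpposite.op
          (Preadditive.add_comp _ _ _ s t _)
        map_smul' := fun c t => funext fun j => congr_arg MulOpposite.op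
          (Category.assoc (show X ⟶ X from c.unop) t _) }
    have hκ {l : ℕ} : Function.Injective (κ (l := l)) := fun s t h =>
      biproduct.hom_ext _ _ fun j => congr_arg MulOpposite.unop (congr_fun h j)
    have hκ' {l : ℕ} : Function.Surjective (κ (l := l)) := fun x =>
      ⟨biproduct.lift fun j => (x j).unop, funext fun j =>
        congr_arg MulOpposite.op (biproduct.lift_π _ j)⟩
    -- Under the coordinate isomorphism `κ`, composing with `p` becomes forming linear combinations
    -- of the relations.
    have hκp (s : X ⟶ Q m) : κ (s ≫ p) = ∑ l, κ s l • r l := by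
      refine funext fun j => MulOpposite.unop_injective ?_
      rw [Finset.sum_apply, Finset.unop_sum]
      change (s ≫ p) ≫ biproduct.π (fun _ : Fin n => X) j = ∑ l,
        (s ≫ biproduct.π (fun _ : Fin m => X) l) ≫ (r l j).unop
      rw [Category.assoc, biproduct.matrix_π, ← Category.id_comp (biproduct.desc _),
        ← biproduct.total, Preadditive.sum_comp, Preadditive.comp_sum]
      exact Finset.sum_congr rfl fun l _ => by
        rw [Category.assoc, biproduct.ι_desc, Category.assoc]
    let γ : (X ⟶ Q n) →ₗ[(End X)ᵐᵒᵖ] M := β ∘ₗ κ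
    have hγ : Function.Surjective γ := hβ.comp hκ'
    let Y : (presentable X).FullSubcategory := ⟨cokernel p, Q m, Q n, p, cokernel.π p,
      cokernel.condition p, addClosure_self_sum X m, addClosure_self_sum X n,
      ShortComplex.exact_of_g_is_cokernel _ (cokernelIsCokernel p), inferInstance⟩
    let δ : (X ⟶ Q n) →ₗ[(End X)ᵐᵒᵖ] (X ⟶ cokernel p) :=
      ((homFunctor k X).map (cokernel.π p)).hom.hom
    have hδ : Function.Surjective δ := fun t =>
      ⟨Projective.factorThru t (cokernel.π p), Projective.factorThru_comp t (cokernel.π p)⟩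
    -- `M` and `Hom(X, cokernel p)` are both quotients of `Hom(X, X^n)`. In each case the kernel
    -- consists of the maps factoring through `p`, by exactness of `Hom(X, -)` and by the choice of
    -- `r` respectively.
    have hker : LinearMap.ker δ = LinearMap.ker γ := by
      ext t
      constructor
      · intro ht
        have hex : (ShortComplex.mk p (cokernel.π p) (cokernel.condition p)).Exact :=
          ShortComplex.exact_of_g_is_cokernel _ (cokernelIsCokernel p)
        obtain ⟨s, rfl⟩ : ∃ s, s ≫ p = t :=
          ⟨hex.liftFromProjective t ht, hex.liftFromProjective_comp t ht⟩
        change κ (s ≫ p) ∈ LinearMap.ker β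
        rw [hκp, ← hr]
        exact Submodule.sum_mem _ fun l _ =>
          Submodule.smul_mem _ _ (Submodule.subset_span ⟨l, rfl⟩)
      · intro ht
        change κ t ∈ LinearMap.ker β at ht
        rw [← hr, Submodule.mem_span_range_iff_exists_fun] at ht
        obtain ⟨c, hc⟩ := ht
        obtain ⟨s, rfl⟩ := hκ' c
        rw [← hκp] at hc
        obtain rfl := hκ hc
        change (s ≫ p) ≫ cokernel.π p = 0
        rw [Category.assoc, cokernel.condition, Limits.comp_zero]
    let e : (X ⟶ cokernel p) ≃ₗ[(End X)ᵐᵒᵖ] M :=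
      (δ.quotKerEquivOfSurjective hδ).symm ≪≫ₗ Submodule.quotEquivOfEq _ _ hker ≪≫ₗ
        γ.quotKerEquivOfSurjective hγ
    have := finite_hom k X (cokernel p)
    exact ⟨Y, ⟨e.toFGModuleCatIso⟩⟩

theorem presentable_homFunctor_isEquivalence :
    ((presentable X).ι ⋙ homFunctor k X).IsEquivalence where

end Presentable

/-! ### The subcategory `𝒩_S` as modules over `D_S` -/

section Serre

section

variable {A : Type u} [Ring A]

theorem module_projective_of_retract {X Y : FGModuleCat.{u} A} (h : Retract Y X)
    [Module.Projective A X] : Module.Projective A Y :=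
  Module.Projective.of_split h.i.hom.hom h.r.hom.hom
    (congr_arg (fun f => f.hom.hom) h.retract)

/-- A finite free cover already lies in the category and splits. This supplies the module-theoretic
projectivity used by the dual basis argument for the trace ideal. -/
theorem module_projective_of_projective (X : FGModuleCat.{u} A) [Projective X] :
    Module.Projective A X := by
  obtain ⟨m, f, hf⟩ := Module.Finite.exists_fin' A X
  let g : FGModuleCat.of A (Fin m → A) ⟶ X := FGModuleCat.ofHom f
  have hg : Epi g := (epi_iff_surjective g).2 hf
  have : Module.Projective A (FGModuleCat.of A (Fin m → A)) :=
    inferInstanceAs (Module.Projective A (Fin m → A))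
  exact module_projective_of_retract
    { i := Projective.factorThru (𝟙 X) g, r := g, retract := Projective.factorThru_comp _ _ }

end

variable {A : Type u} [Ring A] [IsArtinianRing A] {n : ℕ} {L P : Fin n → FGModuleCat.{u} A}
  {π : ∀ i, P i ⟶ L i} {S : Set (Fin n)}

theorem serre_iff_traceIdeal (hL : IsCompleteSimpleList L) (hP : ∀ i, IsProjectiveCover (π i))
    (M : FGModuleCat.{u} A) :
    serre L S M ↔ ∀ a ∈ traceIdeal (coverSum P Sᶜ), ∀ x : M, a • x = 0 := by
  have := projective_coverSum hP Sᶜ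
  have := module_projective_of_projective (coverSum P Sᶜ)
  rw [serre_iff_coverFree hL hP, coverFree_iff_coverSum, hom_eq_zero_iff_traceIdeal]

theorem serre_quotientRestrict (hL : IsCompleteSimpleList L) (hP : ∀ i, IsProjectiveCover (π i))
    (M : FGModuleCat.{u} (quotientAlgebra P S)) :
    serre L S ((quotientRestrict (traceIdeal (coverSum P Sᶜ))).obj M) :=
  (serre_iff_traceIdeal hL hP _).2 fun _ ha x => smul_quotientRestrict_obj _ M ha x

theorem isEquivalence_lift_quotientRestrict (hL : IsCompleteSimpleList L)
    (hP : ∀ i, IsProjectiveCover (π i)) :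
    ((serre L S).lift (quotientRestrict (traceIdeal (coverSum P Sᶜ)))
      (serre_quotientRestrict hL hP)).IsEquivalence where
  essSurj := ⟨fun M => by
    obtain ⟨N, ⟨e⟩⟩ := exists_quotientRestrict_iso (traceIdeal (coverSum P Sᶜ)) M.obj
      ((serre_iff_traceIdeal hL hP _).1 M.property)
    exact ⟨N, ⟨(serre L S).fullyFaithfulι.preimageIso e⟩⟩⟩

end Serre

/-! ### Additivity and linearity of lifts and of inverse equivalences -/

section Inverse

variable {C : Type u₁} [Category.{v₁} C] [Preadditive C] {D : Type u₂} [Category.{v₂} D]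
  [Preadditive D]

instance lift_additive (Q : ObjectProperty C) (G : D ⥤ C) [G.Additive]
    (hG : ∀ X, Q (G.obj X)) : (Q.lift G hG).Additive where
  map_add := ObjectProperty.hom_ext _ G.map_add

instance lift_linear (k : Type w) [Ring k] [Linear k C] [Linear k D] (Q : ObjectProperty C)
    (G : D ⥤ C) [G.Additive] [G.Linear k] (hG : ∀ X, Q (G.obj X)) : (Q.lift G hG).Linear k where
  map_smul f r := ObjectProperty.hom_ext _ (G.map_smul r f)

variable (E : D ⥤ C) [E.IsEquivalence]

instance inv_additive [E.Additive] : E.inv.Additive :=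
  have : E.asEquivalence.functor.Additive := inferInstanceAs E.Additive
  E.asEquivalence.inverse_additive

instance inv_linear (k : Type w) [Ring k] [Linear k C] [Linear k D] [E.Additive] [E.Linear k] :
    E.inv.Linear k :=
  have : E.asEquivalence.functor.Linear k := inferInstanceAs (E.Linear k)
  E.asEquivalence.inverseLinear k

end Inverse

end

end SelfadjointFunctors

/-! ### The main theorem -/

open SelfadjointFunctors in
theorem mainTheorem10 {k : Type w} [Field k] [IsAlgClosed k]
    {A : Type u} [Ring A] [Algebra k A] [Module.Finite k A] (hA : IsBasicAlgebra k A)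
    {n : ℕ} (L P : Fin n → FGModuleCat.{u} A) (hL : IsCompleteSimpleList L)
    (π : ∀ i, P i ⟶ L i) (hP : ∀ i, IsProjectiveCover (π i))
    (F : FGModuleCat.{u} A ⥤ FGModuleCat.{u} A) [F.Additive] [F.Linear k]
    (hF : IsSelfadjointFunctor F)
    (S : Set (Fin n)) (hS : S ⊂ Set.univ)
    (hinv : ∀ x ∈ classSpan L S, K0map F hF.map_shortExact x ∈ classSpan L S) :
    ∃ (hN : ∀ M, serre L S M → serre L S (F.obj M))
      (hX : ∀ M, presentable (coverSum P Sᶜ) M → presentable (coverSum P Sᶜ) (F.obj M))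
      (hD : ∀ M : FGModuleCat.{u} (quotientAlgebra P S),
        serre L S ((quotientRestrict (traceIdeal (coverSum P Sᶜ))).obj M))
      (_ : ((serre L S).lift (quotientRestrict (traceIdeal (coverSum P Sᶜ))) hD).IsEquivalence)
      (_ : ((presentable (coverSum P Sᶜ)).ι ⋙ homFunctor k (coverSum P Sᶜ)).IsEquivalence),
      let Ψ : FGModuleCat.{u} (quotientAlgebra P S) ⥤ (serre L S).FullSubcategory :=
        (serre L S).lift (quotientRestrict (traceIdeal (coverSum P Sᶜ))) hD
      let Φ : (presentable (coverSum P Sᶜ)).FullSubcategory ⥤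
          FGModuleCat.{u} (centralizerAlgebra P Sᶜ) :=
        (presentable (coverSum P Sᶜ)).ι ⋙ homFunctor k (coverSum P Sᶜ)
      let Fhat : FGModuleCat.{u} (quotientAlgebra P S) ⥤ FGModuleCat.{u} (quotientAlgebra P S) :=
        Ψ ⋙ restrict (serre L S) F hN ⋙ Ψ.inv
      let Fbar : FGModuleCat.{u} (centralizerAlgebra P Sᶜ) ⥤
          FGModuleCat.{u} (centralizerAlgebra P Sᶜ) :=
        Φ.inv ⋙ restrict (presentable (coverSum P Sᶜ)) F hX ⋙ Φ
      (IsSelfadjointFunctor Fhat ∧ Fhat.Additive ∧ Fhat.Linear k) ∧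
      (IsSelfadjointFunctor Fbar ∧ Fbar.Additive ∧ Fbar.Linear k) ∧
      ∀ g h : ℕ[X], Nonempty (polyFunctor g F ≅ polyFunctor h F) →
        Nonempty (polyFunctor g Fhat ≅ polyFunctor h Fhat) ∧
        Nonempty (polyFunctor g Fbar ≅ polyFunctor h Fbar) := by
  have : IsArtinianRing A := IsArtinianRing.of_finite k A
  have := projective_coverSum hP Sᶜ
  have hC : ∀ M, CoverFree P S M → CoverFree P S (F.obj M) := fun M =>
    coverFree_map k hL hP F hF.map_shortExact hinv
  have hN : ∀ M, serre L S M → serre L S (F.obj M) := fun M hM =>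
    (serre_iff_coverFree hL hP _).2 (hC M ((serre_iff_coverFree hL hP _).1 hM))
  have hX : ∀ M, presentable (coverSum P Sᶜ) M → presentable (coverSum P Sᶜ) (F.obj M) :=
    fun M => presentable_map hL hP hF.some hC
  have hD := serre_quotientRestrict (S := S) hL hP
  have hΨ := isEquivalence_lift_quotientRestrict (S := S) hL hP
  have hΦ := presentable_homFunctor_isEquivalence k (coverSum P Sᶜ)
  refine ⟨hN, hX, hD, hΨ, hΦ, ?_⟩
  intro Ψ Φ Fhat Fbar
  have hΨa : Ψ.Additive := lift_additive _ _ hD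
  have hΨl : Ψ.Linear k := lift_linear k _ _ hD
  have hΦa : Φ.Additive := inferInstanceAs
    ((presentable (coverSum P Sᶜ)).ι ⋙ homFunctor k (coverSum P Sᶜ)).Additive
  have hΦl : Φ.Linear k := inferInstanceAs
    (((presentable (coverSum P Sᶜ)).ι ⋙ homFunctor k (coverSum P Sᶜ)).Linear k)
  have := hΦ
  let eΨ : FGModuleCat.{u} (quotientAlgebra P S) ≌ (serre L S).FullSubcategory := Ψ.asEquivalence
  let eΦ : (presentable (coverSum P Sᶜ)).FullSubcategory ≌
    FGModuleCat.{u} (centralizerAlgebra P Sᶜ) := Φ.asEquivalence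
  -- The embeddings into `A`-modules are `Ψ ⋙ ι` and `Φ.inv ⋙ ι`. Only the counit of `Ψ` and the
  -- unit of `Φ` have to be inserted; restricted functors commute with `ι` by definition.
  have iΨ : Fhat ⋙ Ψ ⋙ (serre L S).ι ≅ (Ψ ⋙ (serre L S).ι) ⋙ F :=
    Functor.isoWhiskerLeft (Ψ ⋙ restrict (serre L S) F hN)
      (Functor.isoWhiskerRight eΨ.counitIso (serre L S).ι)
  have iΦ : Fbar ⋙ Φ.inv ⋙ (presentable (coverSum P Sᶜ)).ι ≅
      (Φ.inv ⋙ (presentable (coverSum P Sᶜ)).ι) ⋙ F :=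
    Functor.isoWhiskerLeft (Φ.inv ⋙ restrict (presentable (coverSum P Sᶜ)) F hX)
      (Functor.isoWhiskerRight eΦ.unitIso.symm (presentable (coverSum P Sᶜ)).ι)
  refine ⟨⟨(hF.restrict _ hN).conjugate eΨ, inferInstance, inferInstance⟩,
    ⟨(hF.restrict _ hX).conjugate eΦ.symm, inferInstance, inferInstance⟩, fun g h i =>
    ⟨nonempty_polyFunctor_iso iΨ g h i, nonempty_polyFunctor_iso iΦ g h i⟩⟩
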